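/- Let $L\ge 1$ be an integer and let $$D=\Big\{(p,q_1,\dots,q_L):\ p>0,\ q_j\ge 0\ (1\le j\le L),\ p+\sum_{j=1}^L q_j=1,\ \sum_{j=1}^L j\,q_j>p\Big\}.$$ For $P=(p,q_1,\dots,q_L)\in D$ let $M=M(P)$ be the $L\times L$ matrix with entries $M_{ab}=q_b/p+\mathbf 1_{\{a=b+1\}}$, let $\rho(M)$ be its spectral radius (the largest modulus of a complex eigenvalue), and let $\lambda_M$ be its largest real eigenvalue. (1) If $P\in D$, then $\lambda_M$ exists and $\lambda_M=\rho(M)>1$. (2) For every $i\ge 1$ let $P(i)=(p(i),q_1(i),\dots,q_L(i))$ satisfy $0<p(i)<1$, $q_j(i)\ge 0$ and $p(i)+\sum_{j=1}^L q_j(i)=1$. Consider the reflecting $(L,1)$-random walk on $\{0,1,2,\dots\}$, that is, the Markov chain that moves from $0$ to $1$ with probability $1$ and that moves from $i\ge1$ to $i+1$ with probability $p(i)$ and to $\max(i-j,0)$ by a jump of size $j$ with probability $q_j(i)$, for $j=1,\dots,L$ (the probabilities of jumps that lead to $0$ are added up). If $P(i)\to P$ as $i\to\infty$ for some $P\in D$,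 then the walk has a unique stationary probability distribution $\pi$, we have $\pi(i)>0$ for all $i$, and $$\lim_{i\to\infty}\frac{\log \pi(i)}{i}=-\log\lambda_M .$$ -/

import Mathlib

open Filter Topology

noncomputable section

namespace L1Walk

/-- The set `D` of points `P = (p, q₁, …, q_L)` of the simplex with `p > 0` and `∑ j q_j > p`.
The index `k : Fin L` stands for the jump size `j = k + 1`. -/
def D (L : ℕ) : Set (ℝ × (Fin L → ℝ)) :=
  {P | P.1 + ∑ k, P.2 k = 1 ∧ P.1 < ∑ k : Fin L, ((k : ℝ) + 1) * P.2 k ∧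
    (∀ k, 0 ≤ P.2 k) ∧ 0 < P.1}

/-- The offspring mean matrix: every row is `(q₁/p, …, q_L/p)`, and `1` is added on the
subdiagonal. -/
def offspringMatrix {L : ℕ} (P : ℝ × (Fin L → ℝ)) : Matrix (Fin L) (Fin L) ℝ :=
  Matrix.of fun a b => P.2 b / P.1 + if (a : ℕ) = (b : ℕ) + 1 then 1 else 0

/-- The maximal (real) eigenvalue of a real square matrix. -/
def maxEigenvalue {L : ℕ} (M : Matrix (Fin L) (Fin L) ℝ) : ℝ :=
  sSup {μ : ℝ | Module.End.HasEigenvalue (Matrix.toLin' M) μ}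

/-- Admissible step probabilities `p(i), q₁(i), …, q_L(i)` at the states `i ≥ 1`
(at state `0` the walk always steps to `1`, so nothing is asked there). -/
def IsStepLaw {L : ℕ} (p : ℕ → ℝ) (q : ℕ → Fin L → ℝ) : Prop :=
  ∀ i, 1 ≤ i → 0 < p i ∧ p i < 1 ∧ (∀ k, 0 ≤ q i k) ∧ p i + ∑ k, q i k = 1

/-- The transition matrix of the reflecting `(L,1)`-walk on `{0, 1, 2, …}`: from `0` the walk
steps to `1`; from `i ≥ 1` it steps to `i + 1` with probability `p i`, and for `k : Fin L`, with
probability `q i k`, it jumps down by `k + 1`, to `max (i - (k + 1)) 0` (truncated subtraction). -/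
def transition {L : ℕ} (p : ℕ → ℝ) (q : ℕ → Fin L → ℝ) (i j : ℕ) : ℝ :=
  if i = 0 then (if j = 1 then 1 else 0)
  else (if j = i + 1 then p i else 0) + ∑ k : Fin L, if j = i - ((k : ℕ) + 1) then q i k else 0

/-- `π` is a stationary probability distribution of the transition matrix `T` on `ℕ`. -/
def IsStationaryDistribution (T : ℕ → ℕ → ℝ) (π : ℕ → ℝ) : Prop :=
  (∀ i, 0 ≤ π i) ∧ HasSum π 1 ∧ ∀ j, HasSum (fun i => π i * T i j) (π j)

end L1Walk

end

namespace L1Walk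

open Finset

/-! ### Linear backward recursions with nonnegative coefficients -/

/-! Balancing the flow across the edge between `i` and `i + 1` turns stationarity into a backward
recursion `u i = ∑ a i m * u (i + m + 1)` with nonnegative coefficients (`invariant_of_cut`),
tending to `tail P.2 m / P.1`. The limiting recursion has the solution `x ^ i` when `genFun P x =
1`. Since `genFun P` increases from 0 at 0 to `∑ j q_j / p > 1` at 1, there is a root `x₀ < 1`. The
vector with entries `x₀ + ⋯ + x₀ ^ (a + 1)` is a positive eigenvector for `x₀⁻¹`, which is therefore
both the largest real eigenvalue and the spectral radius.

Dividing a solution by `x ^ i` makes the row sums approach `genFun P x`. They are eventually at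
least 1 for `x > x₀` and at most 1 for `x < x₀`; a minimum or maximum principle on windows of length
`L` then bounds solutions by geometric sequences on either side. The upper bound is uniform over
supersolutions, so normalized truncated solutions have a limit point, summable because `x` may be
taken below 1. Positivity and uniqueness come from irreducibility. -/

/-- Along a supersolution of a backward recursion whose coefficients have row sums at least `1`,
the value at `K` controls all later values. -/
theorem supersolution_le {L K : ℕ} (hL : 0 < L) {b : ℕ → ℕ → ℝ} {c : ℝ} (hc : 0 < c) (hc1 : c ≤ 1)
    (hb : ∀ i m, 0 ≤ b i m) (hbc : ∀ i, K ≤ i → c ≤ b i 0)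
    (hsum : ∀ i, K ≤ i → 1 ≤ ∑ m ∈ range L, b i m)
    {v : ℕ → ℝ} (hv : ∀ i, 0 ≤ v i)
    (hsup : ∀ i, ∑ m ∈ range L, b i m * v (i + m + 1) ≤ v i) (n : ℕ) (hn : K + L ≤ n) :
    c ^ L * v n ≤ v K := by
  have step : ∀ i, K ≤ i → c * v (i + 1) ≤ v i := by
    intro i hi
    calc c * v (i + 1) ≤ b i 0 * v (i + 0 + 1) :=
          mul_le_mul_of_nonneg_right (hbc i hi) (hv _)
      _ ≤ ∑ m ∈ range L, b i m * v (i + m + 1) :=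
          single_le_sum (f := fun m => b i m * v (i + m + 1))
            (fun m _ => mul_nonneg (hb i m) (hv _)) (mem_range.2 hL)
      _ ≤ v i := hsup i
  have steps : ∀ k i, K ≤ i → c ^ k * v (i + k) ≤ v i := by
    intro k
    induction k with
    | zero => intro i _; simp
    | succ k ih =>
      intro i hi
      have h1 := ih (i + 1) (by omega)
      have h2 := step i hi
      rw [show i + (k + 1) = i + 1 + k by ring, pow_succ', mul_assoc]
      exact (mul_le_mul_of_nonneg_left h1 hc.le).trans h2
  -- Minimum principle: each window of `L` indices contains a value at most `v K`. If sliding the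
  -- window loses the only such index, the recursion there, with row sum at least 1, gives a
  -- contradiction.
  have window : ∀ d, ∃ m, K + d ≤ m ∧ m < K + d + L ∧ v m ≤ v K := by
    intro d
    induction d with
    | zero => exact ⟨K, by omega, by omega, le_rfl⟩
    | succ d ih =>
      obtain ⟨m, h1, h2, h3⟩ := ih
      by_cases hm : m = K + d
      · subst hm
        by_contra! hcon
        have hlt : ∀ m ∈ range L, v K < v (K + d + m + 1) := fun m hm => by
          have := mem_range.1 hm
          exact hcon _ (by omega) (by omega)
        have : v K < v (K + d) := by
          calc v K ≤ (∑ m ∈ range L, b (K + d) m) * v K :=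
                le_mul_of_one_le_left (hv K) (hsum _ (by omega))
            _ = ∑ m ∈ range L, b (K + d) m * v K := sum_mul ..
            _ < ∑ m ∈ range L, b (K + d) m * v (K + d + m + 1) :=
                sum_lt_sum (fun m hm => mul_le_mul_of_nonneg_left (hlt m hm).le (hb _ _))
                  ⟨0, mem_range.2 hL, mul_lt_mul_of_pos_left (hlt 0 (mem_range.2 hL))
                    (hc.trans_le (hbc _ (by omega)))⟩
            _ ≤ v (K + d) := hsup _
        exact absurd h3 (not_le.2 this)
      · exact ⟨m, by omega, by omega, h3⟩
  -- This window is the one ending just before `n`, so `n` is at most `L` single steps beyond `m`.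
  obtain ⟨m, h1, h2, h3⟩ := window (n - K - L)
  obtain ⟨k, rfl⟩ : ∃ k, n = m + k := ⟨n - m, by omega⟩
  calc c ^ L * v (m + k) ≤ c ^ k * v (m + k) :=
        mul_le_mul_of_nonneg_right (pow_le_pow_of_le_one hc.le hc1 (by omega)) (hv _)
    _ ≤ v m := steps k m (by omega)
    _ ≤ v K := h3

/-- A solution of a backward recursion whose coefficients have row sums at most `1` stays bounded
below by a multiple of its value at `K`. -/
theorem le_solution {L K : ℕ} (hL : 0 < L) {b : ℕ → ℕ → ℝ} {c : ℝ} (hc : 0 < c) (hc1 : c ≤ 1)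
    (hb : ∀ i m, 0 ≤ b i m) (hbc : ∀ i, K ≤ i → c ≤ b i 0)
    (hsum : ∀ i, K ≤ i → ∑ m ∈ range L, b i m ≤ 1)
    {v : ℕ → ℝ} (hv : ∀ i, 0 ≤ v i)
    (hsol : ∀ i, v i = ∑ m ∈ range L, b i m * v (i + m + 1)) (n : ℕ) (hn : K ≤ n) :
    c ^ L * v K ≤ v n := by
  have step : ∀ i, K ≤ i → c * v (i + 1) ≤ v i := by
    intro i hi
    calc c * v (i + 1) ≤ b i 0 * v (i + 0 + 1) :=
          mul_le_mul_of_nonneg_right (hbc i hi) (hv _)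
      _ ≤ ∑ m ∈ range L, b i m * v (i + m + 1) :=
          single_le_sum (f := fun m => b i m * v (i + m + 1))
            (fun m _ => mul_nonneg (hb i m) (hv _)) (mem_range.2 hL)
      _ = v i := (hsol i).symm
  have steps : ∀ k i, K ≤ i → c ^ k * v (i + k) ≤ v i := by
    intro k
    induction k with
    | zero => intro i _; simp
    | succ k ih =>
      intro i hi
      have h1 := ih (i + 1) (by omega)
      have h2 := step i hi
      rw [show i + (k + 1) = i + 1 + k by ring, pow_succ', mul_assoc]
      exact (mul_le_mul_of_nonneg_left h1 hc.le).trans h2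
  have window : ∀ d, ∃ m, K + d ≤ m ∧ m < K + d + L ∧ v K ≤ v m := by
    intro d
    induction d with
    | zero => exact ⟨K, by omega, by omega, le_rfl⟩
    | succ d ih =>
      obtain ⟨m, h1, h2, h3⟩ := ih
      by_cases hm : m = K + d
      · subst hm
        by_contra! hcon
        have hlt : ∀ m ∈ range L, v (K + d + m + 1) < v K := fun m hm => by
          have := mem_range.1 hm
          exact hcon _ (by omega) (by omega)
        have : v (K + d) < v K := by
          calc v (K + d) = ∑ m ∈ range L, b (K + d) m * v (K + d + m + 1) := hsol _
            _ < ∑ m ∈ range L, b (K + d) m * v K :=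
                sum_lt_sum (fun m hm => mul_le_mul_of_nonneg_left (hlt m hm).le (hb _ _))
                  ⟨0, mem_range.2 hL, mul_lt_mul_of_pos_left (hlt 0 (mem_range.2 hL))
                    (hc.trans_le (hbc _ (by omega)))⟩
            _ = (∑ m ∈ range L, b (K + d) m) * v K := (sum_mul ..).symm
            _ ≤ v K := mul_le_of_le_one_left (hv K) (hsum _ (by omega))
        exact absurd h3 (not_le.2 this)
      · exact ⟨m, by omega, by omega, h3⟩
  obtain ⟨m, h1, h2, h3⟩ := window (n - K)
  obtain ⟨k, rfl⟩ : ∃ k, m = n + k := ⟨m - n, by omega⟩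
  calc c ^ L * v K ≤ c ^ L * v (n + k) := mul_le_mul_of_nonneg_left h3 (by positivity)
    _ ≤ c ^ k * v (n + k) :=
        mul_le_mul_of_nonneg_right (pow_le_pow_of_le_one hc.le hc1 (by omega)) (hv _)
    _ ≤ v n := steps k n hn

/-- The substitution `v i = u i / x ^ i` multiplies the coefficients by `x ^ (m + 1)`, so growth
relative to `x ^ i` is decided by comparing row sums with 1. -/
theorem rescaled_sum {L : ℕ} (a : ℕ → ℕ → ℝ) {x : ℝ} (hx : 0 < x) (u : ℕ → ℝ) (i : ℕ) :
    ∑ m ∈ range L, (a i m * x ^ (m + 1)) * (u (i + m + 1) / x ^ (i + m + 1)) =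
      (∑ m ∈ range L, a i m * u (i + m + 1)) / x ^ i := by
  rw [sum_div]
  refine sum_congr rfl fun m _ => ?_
  have h : x ^ (i + m + 1) = x ^ i * x ^ (m + 1) := by rw [← pow_add, add_assoc]
  rw [h]
  field_simp

/-- Uniform geometric upper bound for supersolutions, in terms of the value at `0`. -/
theorem exists_supersolution_bound {L : ℕ} (hL : 0 < L) {a : ℕ → ℕ → ℝ} {c x : ℝ} (hc : 0 < c)
    (hx : 0 < x) (ha : ∀ i m, 0 ≤ a i m) (ha0 : ∀ i, 0 < a i 0)
    (hac : ∀ᶠ i in atTop, c ≤ a i 0)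
    (hsum : ∀ᶠ i in atTop, 1 ≤ ∑ m ∈ range L, a i m * x ^ (m + 1)) :
    ∃ C : ℝ, 0 < C ∧ ∀ u : ℕ → ℝ, (∀ i, 0 ≤ u i) →
      (∀ i, ∑ m ∈ range L, a i m * u (i + m + 1) ≤ u i) → ∀ n, u n ≤ C * x ^ n * u 0 := by
  obtain ⟨K, hK⟩ := eventually_atTop.1 (hac.and hsum)
  -- Before the asymptotic regime, the term `m = 0` alone controls each value by `u 0`, with a
  -- constant not depending on `u`.
  have small : ∀ n, ∃ A : ℝ, 0 < A ∧ ∀ u : ℕ → ℝ, (∀ i, 0 ≤ u i) →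
      (∀ i, ∑ m ∈ range L, a i m * u (i + m + 1) ≤ u i) → u n ≤ A * u 0 := by
    intro n
    induction n with
    | zero => exact ⟨1, one_pos, fun u _ _ => by simp⟩
    | succ n ih =>
      obtain ⟨A, hA, h⟩ := ih
      refine ⟨A / a n 0, div_pos hA (ha0 n), fun u hu hs => ?_⟩
      have h1 : a n 0 * u (n + 1) ≤ u n :=
        (single_le_sum (f := fun m => a n m * u (n + m + 1))
            (fun m _ => mul_nonneg (ha n m) (hu _)) (mem_range.2 hL)).trans (hs n)
      rw [div_mul_eq_mul_div, le_div_iff₀ (ha0 n), mul_comm]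
      exact h1.trans (h u hu hs)
  choose A hA hA' using small
  -- The rescaled leading coefficient is at least `c * x`; the cap at 1 makes the powers of `c'`
  -- decreasing.
  set c' := min (c * x) 1 with hc'
  have hc'0 : 0 < c' := lt_min (mul_pos hc hx) one_pos
  set C₀ := A K / x ^ K / c' ^ L with hC₀
  have hC₀pos : 0 < C₀ := by have := hA K; positivity
  have hterm : ∀ n, 0 < A n / x ^ n := fun n => by have := hA n; positivity
  refine ⟨C₀ + ∑ n ∈ range (K + L), A n / x ^ n,
    add_pos_of_pos_of_nonneg hC₀pos (sum_nonneg fun n _ => (hterm n).le), fun u hu hs n => ?_⟩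
  have hmono : ∀ B, B ≤ C₀ + ∑ n ∈ range (K + L), A n / x ^ n → u n ≤ B * x ^ n * u 0 →
      u n ≤ (C₀ + ∑ n ∈ range (K + L), A n / x ^ n) * x ^ n * u 0 := fun B hB h =>
    h.trans (mul_le_mul_of_nonneg_right (mul_le_mul_of_nonneg_right hB (by positivity)) (hu 0))
  rcases lt_or_ge n (K + L) with hn | hn
  · refine hmono (A n / x ^ n) ?_ ?_
    · have := single_le_sum (f := fun n => A n / x ^ n) (fun n _ => (hterm n).le)
        (mem_range.2 hn)
      linarith
    · rw [div_mul_cancel₀ _ (by positivity)]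
      exact hA' n u hu hs
  · refine hmono C₀ (le_add_of_nonneg_right (sum_nonneg fun n _ => (hterm n).le)) ?_
    have key := supersolution_le (K := K) hL (b := fun i m => a i m * x ^ (m + 1)) hc'0
      (min_le_right _ _) (fun i m => mul_nonneg (ha i m) (by positivity))
      (fun i hi => by
        rw [zero_add, pow_one]
        exact (min_le_left _ _).trans (mul_le_mul_of_nonneg_right (hK i hi).1 hx.le))
      (fun i hi => (hK i hi).2) (v := fun i => u i / x ^ i)
      (fun i => div_nonneg (hu i) (by positivity))
      (fun i => by
        rw [rescaled_sum a hx]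
        exact div_le_div_of_nonneg_right (hs i) (by positivity)) n hn
    have h2 : u K / x ^ K ≤ A K * u 0 / x ^ K :=
      div_le_div_of_nonneg_right (hA' K u hu hs) (by positivity)
    have h3 : u n / x ^ n ≤ A K * u 0 / x ^ K / c' ^ L := by
      rw [le_div_iff₀ (by positivity), mul_comm]
      exact key.trans h2
    rw [div_le_iff₀ (by positivity)] at h3
    calc u n ≤ A K * u 0 / x ^ K / c' ^ L * x ^ n := h3
      _ = C₀ * x ^ n * u 0 := by rw [hC₀]; ring

/-- Geometric lower bound for positive solutions. -/
theorem exists_solution_lower_bound {L : ℕ} (hL : 0 < L) {a : ℕ → ℕ → ℝ} {c x : ℝ} (hc : 0 < c)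
    (hx : 0 < x) (ha : ∀ i m, 0 ≤ a i m) (hac : ∀ᶠ i in atTop, c ≤ a i 0)
    (hsum : ∀ᶠ i in atTop, ∑ m ∈ range L, a i m * x ^ (m + 1) ≤ 1)
    {u : ℕ → ℝ} (hu : ∀ i, 0 < u i) (hsol : ∀ i, u i = ∑ m ∈ range L, a i m * u (i + m + 1)) :
    ∃ C : ℝ, 0 < C ∧ ∀ᶠ n in atTop, C * x ^ n ≤ u n := by
  obtain ⟨K, hK⟩ := eventually_atTop.1 (hac.and hsum)
  set c' := min (c * x) 1 with hc'
  have hc'0 : 0 < c' := lt_min (mul_pos hc hx) one_pos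
  have huK := hu K
  refine ⟨c' ^ L * (u K / x ^ K), by positivity, eventually_atTop.2 ⟨K, fun n hn => ?_⟩⟩
  have key := le_solution (K := K) hL (b := fun i m => a i m * x ^ (m + 1)) hc'0
    (min_le_right _ _) (fun i m => mul_nonneg (ha i m) (by positivity))
    (fun i hi => by
      rw [zero_add, pow_one]
      exact (min_le_left _ _).trans (mul_le_mul_of_nonneg_right (hK i hi).1 hx.le))
    (fun i hi => (hK i hi).2) (v := fun i => u i / x ^ i)
    (fun i => div_nonneg (hu i).le (by positivity))
    (fun i => by rw [rescaled_sum a hx, ← hsol i]) n hn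
  exact (le_div_iff₀ (by positivity)).1 key

/-- The solution of the recursion below `N` with value `1` at `N` and `0` above `N`. -/
theorem exists_truncated_solution {L : ℕ} {a : ℕ → ℕ → ℝ} (ha : ∀ i m, 0 ≤ a i m) (N : ℕ) :
    ∃ u : ℕ → ℝ, (∀ i, 0 ≤ u i) ∧ u N = 1 ∧ (∀ i, N < i → u i = 0) ∧
      ∀ i, i < N → u i = ∑ m ∈ range L, a i m * u (i + m + 1) := by
  suffices h : ∀ k, ∃ u : ℕ → ℝ, (∀ i, 0 ≤ u i) ∧ u N = 1 ∧ (∀ i, N < i → u i = 0) ∧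
      ∀ i, i < N → N ≤ i + k → u i = ∑ m ∈ range L, a i m * u (i + m + 1) by
    obtain ⟨u, h1, h2, h3, h4⟩ := h N
    exact ⟨u, h1, h2, h3, fun i hi => h4 i hi (by omega)⟩
  intro k
  induction k with
  | zero =>
    refine ⟨Pi.single N 1, fun i => ?_, by simp, fun i hi => by simp [hi.ne'],
      fun i _ _ => by omega⟩
    by_cases h : i = N
    · subst h; simp
    · simp [h]
  | succ k ih =>
    obtain ⟨u, h1, h2, h3, h4⟩ := ih
    by_cases hk : N < k + 1
    · exact ⟨u, h1, h2, h3, fun i hi _ => h4 i hi (by omega)⟩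
    · obtain ⟨j, rfl⟩ : ∃ j, N = j + (k + 1) := ⟨N - (k + 1), by omega⟩
      refine ⟨Function.update u j (∑ m ∈ range L, a j m * u (j + m + 1)), fun i => ?_, ?_,
        fun i hi => ?_, fun i hi hik => ?_⟩
      · by_cases h : i = j
        · subst h
          simpa using sum_nonneg fun m _ => mul_nonneg (ha i m) (h1 _)
        · simpa [h] using h1 i
      · rw [Function.update_of_ne (by omega), h2]
      · rw [Function.update_of_ne (by omega), h3 i hi]
      · have hs : ∀ m, Function.update u j (∑ m ∈ range L, a j m * u (j + m + 1)) (i + m + 1) =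
            u (i + m + 1) := fun m => Function.update_of_ne (by omega) _ _
        simp only [hs]
        by_cases h : i = j
        · subst h; simp
        · rw [Function.update_of_ne h]
          exact h4 i hi (by omega)

/-- Existence of a geometrically decaying solution, by compactness. -/
theorem exists_solution {L : ℕ} (hL : 0 < L) {a : ℕ → ℕ → ℝ} {c x : ℝ} (hc : 0 < c)
    (hx : 0 < x) (ha : ∀ i m, 0 ≤ a i m) (ha0 : ∀ i, 0 < a i 0)
    (hac : ∀ᶠ i in atTop, c ≤ a i 0)
    (hsum : ∀ᶠ i in atTop, 1 ≤ ∑ m ∈ range L, a i m * x ^ (m + 1)) :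
    ∃ (C : ℝ) (u : ℕ → ℝ), (∀ i, 0 ≤ u i) ∧ u 0 = 1 ∧ (∀ i, u i ≤ C * x ^ i) ∧
      ∀ i, u i = ∑ m ∈ range L, a i m * u (i + m + 1) := by
  obtain ⟨C, hC, hbound⟩ := exists_supersolution_bound hL hc hx ha ha0 hac hsum
  choose w hw0 hwN hwtop hwsol using fun N => exists_truncated_solution (L := L) ha N
  -- From `N` on the right-hand side vanishes, so a truncated solution is a supersolution everywhere
  -- and `C` serves for all `N`.
  have hsup : ∀ N i, ∑ m ∈ range L, a i m * w N (i + m + 1) ≤ w N i := by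
    intro N i
    rcases lt_or_ge i N with hi | hi
    · exact (hwsol N i hi).ge
    · rw [sum_eq_zero fun m _ => by rw [hwtop N _ (by omega), mul_zero]]
      exact hw0 N i
  have hb : ∀ N n, w N n ≤ C * x ^ n * w N 0 := fun N => hbound (w N) (hw0 N) (hsup N)
  have hpos : ∀ N, 0 < w N 0 := by
    intro N
    refine (hw0 N 0).lt_of_ne fun h => ?_
    have := hb N N
    rw [hwN, ← h, mul_zero] at this
    linarith
  let y : ℕ → ℕ → ℝ := fun N n => w N n / w N 0
  have hcomp : IsCompact (Set.pi Set.univ fun n : ℕ => Set.Icc (0 : ℝ) (C * x ^ n)) :=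
    isCompact_univ_pi fun n => isCompact_Icc
  obtain ⟨u, hu, φ, hφ, hlim⟩ := hcomp.tendsto_subseq (x := y) fun N n _ =>
    ⟨div_nonneg (hw0 N n) (hw0 N 0), (div_le_iff₀ (hpos N)).2 (hb N n)⟩
  have hlim' : ∀ n, Tendsto (fun k => y (φ k) n) atTop (𝓝 (u n)) := fun n =>
    (tendsto_pi_nhds.1 hlim) n
  refine ⟨C, u, fun i => (hu i trivial).1, ?_, fun i => (hu i trivial).2, fun i => ?_⟩
  · refine tendsto_nhds_unique (hlim' 0) ?_
    have : (fun k => y (φ k) 0) = fun _ => 1 := by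
      funext k; exact div_self (hpos _).ne'
    rw [this]; exact tendsto_const_nhds
  · refine tendsto_nhds_unique (hlim' i)
      ((tendsto_finsetSum _ fun m _ => (hlim' (i + m + 1)).const_mul (a i m)).congr' ?_)
    -- The recursion at a fixed `i` holds for every truncation level above `i`, hence survives the
    -- limit.
    filter_upwards [eventually_gt_atTop i] with k hk
    have h := hwsol (φ k) i (hk.trans_le (hφ.id_le k))
    simp only [y]
    rw [h, sum_div]
    exact sum_congr rfl fun m _ => (mul_div_assoc ..).symm

/-- A positive sequence squeezed between geometric sequences with ratios arbitrarily close to `x₀`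
decays exponentially at rate `log x₀`. -/
theorem tendsto_log_div {u : ℕ → ℝ} (hu : ∀ i, 0 < u i) {x₀ : ℝ} (hx₀ : 0 < x₀)
    (hup : ∀ x, x₀ < x → ∃ C : ℝ, 0 < C ∧ ∀ᶠ n in atTop, u n ≤ C * x ^ n)
    (hlow : ∀ x, 0 < x → x < x₀ → ∃ C : ℝ, 0 < C ∧ ∀ᶠ n in atTop, C * x ^ n ≤ u n) :
    Tendsto (fun n : ℕ => Real.log (u n) / (n : ℝ)) atTop (𝓝 (Real.log x₀)) := by
  have hlin : ∀ C t : ℝ, Tendsto (fun n : ℕ => Real.log C / (n : ℝ) + t) atTop (𝓝 t) := by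
    intro C t
    simpa using (tendsto_const_div_atTop_nhds_zero_nat (Real.log C)).add_const t
  have hlog : ∀ C t : ℝ, 0 < C → ∀ n : ℕ, 0 < n →
      Real.log (C * Real.exp t ^ n) / (n : ℝ) = Real.log C / n + t := by
    intro C t hC n hn
    have : (n : ℝ) ≠ 0 := by positivity
    rw [Real.log_mul hC.ne' (by positivity), Real.log_pow, Real.log_exp]
    field_simp
  refine tendsto_order.2 ⟨fun s hs => ?_, fun s hs => ?_⟩
  · obtain ⟨t, hst, ht⟩ := exists_between hs
    obtain ⟨C, hC, h⟩ := hlow (Real.exp t) (Real.exp_pos t) ((Real.lt_log_iff_exp_lt hx₀).1 ht)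
    filter_upwards [h, eventually_gt_atTop 0, (hlin C t).eventually (lt_mem_nhds hst)]
      with n h1 h2 h3
    rw [← hlog C t hC n h2] at h3
    refine h3.trans_le (div_le_div_of_nonneg_right (Real.log_le_log (by positivity) h1) ?_)
    positivity
  · obtain ⟨t, ht, hst⟩ := exists_between hs
    obtain ⟨C, hC, h⟩ := hup (Real.exp t) ((Real.log_lt_iff_lt_exp hx₀).1 ht)
    filter_upwards [h, eventually_gt_atTop 0, (hlin C t).eventually (gt_mem_nhds hst)]
      with n h1 h2 h3
    rw [← hlog C t hC n h2] at h3
    refine lt_of_le_of_lt (div_le_div_of_nonneg_right (Real.log_le_log (hu n) h1) ?_) h3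
    positivity

/-! ### The spectrum of the offspring matrix -/

/-- A nonnegative matrix with a positive eigenvector for `lam` has no eigenvalue of modulus
greater than `lam`. -/
theorem le_of_pos_eigenvector {ι : Type*} [Fintype ι] {M : Matrix ι ι ℝ}
    (hM : ∀ a b, 0 ≤ M a b) {v : ι → ℝ} (hv : ∀ a, 0 < v a) {lam : ℝ}
    (hlam : ∀ a, ∑ b, M a b * v b = lam * v a) {y : ι → ℝ} (hy : ∀ a, 0 ≤ y a) (hy0 : y ≠ 0)
    {r : ℝ} (hr : ∀ a, r * y a ≤ ∑ b, M a b * y b) : r ≤ lam := by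
  obtain ⟨a₀, ha₀⟩ := Function.ne_iff.1 hy0
  have : Nonempty ι := ⟨a₀⟩
  -- At an index maximizing `y / v`, `y` is dominated by a multiple of `v` with equality at `a`;
  -- that row gives the bound.
  obtain ⟨a, ha⟩ := Finite.exists_max fun a => y a / v a
  have hpos : 0 < y a / v a :=
    (div_pos ((hy a₀).lt_of_ne (Ne.symm ha₀)) (hv a₀)).trans_le (ha a₀)
  have hle : ∀ b, y b ≤ y a / v a * v b := fun b => (div_le_iff₀ (hv b)).1 (ha b)
  have hya : y a / v a * v a = y a := div_mul_cancel₀ _ (hv a).ne'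
  have hya' : 0 < y a := by rw [← hya]; exact mul_pos hpos (hv a)
  refine le_of_mul_le_mul_right ?_ hya'
  calc r * y a ≤ ∑ b, M a b * y b := hr a
    _ ≤ ∑ b, M a b * (y a / v a * v b) :=
        sum_le_sum fun b _ => mul_le_mul_of_nonneg_left (hle b) (hM a b)
    _ = y a / v a * ∑ b, M a b * v b := by
        rw [mul_sum]; exact sum_congr rfl fun b _ => by ring
    _ = lam * y a := by rw [hlam a]; nth_rewrite 2 [← hya]; ring

/-- The mass that a vector gives to the indices at least `m`. -/
noncomputable def tail {L : ℕ} (r : Fin L → ℝ) (m : ℕ) : ℝ := ∑ k : Fin L, if m ≤ (k : ℕ) then r k else 0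

theorem tail_nonneg {L : ℕ} {r : Fin L → ℝ} (hr : ∀ k, 0 ≤ r k) (m : ℕ) : 0 ≤ tail r m :=
  sum_nonneg fun k _ => by split_ifs; exacts [hr k, le_rfl]

theorem tail_zero {L : ℕ} (r : Fin L → ℝ) : tail r 0 = ∑ k, r k := by simp [tail]

theorem tail_length {L : ℕ} (r : Fin L → ℝ) : tail r L = 0 :=
  sum_eq_zero fun k _ => if_neg (by omega)

theorem tail_eq_add {L : ℕ} (r : Fin L → ℝ) (k : Fin L) :
    tail r k = r k + tail r ((k : ℕ) + 1) := by
  have h : r k = ∑ l : Fin L, if l = k then r l else 0 := by simp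
  rw [tail, tail]
  rw [h, ← sum_add_distrib]
  refine sum_congr rfl fun l _ => ?_
  rcases lt_trichotomy (l : ℕ) k with hl | hl | hl
  · rw [if_neg (by omega), if_neg (by rintro rfl; omega), if_neg (by omega), add_zero]
  · rw [if_pos hl.ge, if_pos (Fin.ext hl), if_neg (by omega), add_zero]
  · rw [if_pos hl.le, if_neg (by rintro rfl; omega), if_pos (by omega), zero_add]

theorem continuous_tail {L : ℕ} (m : ℕ) : Continuous fun r : Fin L → ℝ => tail r m := by
  refine continuous_finsetSum _ fun k _ => ?_
  split_ifs
  exacts [continuous_apply k, continuous_const]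

/-- The function whose positive root is the inverse of the maximal eigenvalue. -/
noncomputable def genFun {L : ℕ} (P : ℝ × (Fin L → ℝ)) (x : ℝ) : ℝ :=
  ∑ m ∈ range L, tail P.2 m / P.1 * x ^ (m + 1)

/-- Exchanging the sums exhibits `genFun P x` as the product of the row `q / p` with the candidate
eigenvector; at `x = 1` it is the drift ratio. -/
theorem genFun_eq {L : ℕ} (P : ℝ × (Fin L → ℝ)) (x : ℝ) :
    genFun P x = ∑ k : Fin L, P.2 k / P.1 * ∑ m ∈ range ((k : ℕ) + 1), x ^ (m + 1) := by
  simp only [genFun, tail, sum_div, sum_mul, mul_sum]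
  rw [sum_comm]
  refine sum_congr rfl fun k _ => ?_
  rw [← sum_subset (range_subset_range.2 (show (k : ℕ) + 1 ≤ L by omega))]
  · refine sum_congr rfl fun m hm => ?_
    rw [if_pos (by have := mem_range.1 hm; omega)]
  · intro m _ hm
    rw [if_neg (by have := mt mem_range.2 hm; omega), zero_div, zero_mul]

theorem D_length_pos {L : ℕ} {P : ℝ × (Fin L → ℝ)} (hP : P ∈ D L) : 0 < L := by
  rcases Nat.eq_zero_or_pos L with rfl | h
  · obtain ⟨-, h2, -, h4⟩ := hP
    simp at h2
    linarith
  · exact h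

theorem D_sum_pos {L : ℕ} {P : ℝ × (Fin L → ℝ)} (hP : P ∈ D L) : 0 < ∑ k, P.2 k := by
  obtain ⟨-, h2, h3, h4⟩ := hP
  refine (sum_nonneg fun k _ => h3 k).lt_of_ne fun h => ?_
  have h0 := (sum_eq_zero_iff_of_nonneg fun k _ => h3 k).1 h.symm
  rw [sum_eq_zero fun k hk => by rw [h0 k hk, mul_zero]] at h2
  linarith

theorem genFun_strictMonoOn {L : ℕ} {P : ℝ × (Fin L → ℝ)} (hP : P ∈ D L) :
    StrictMonoOn (genFun P) (Set.Ici 0) := by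
  intro x hx y _ hxy
  have hx : 0 ≤ x := hx
  have ht : ∀ m, 0 ≤ tail P.2 m / P.1 := fun m => div_nonneg (tail_nonneg hP.2.2.1 m) hP.2.2.2.le
  refine sum_lt_sum (fun m _ => mul_le_mul_of_nonneg_left (pow_le_pow_left₀ hx hxy.le _) (ht m))
    ⟨0, mem_range.2 (D_length_pos hP), mul_lt_mul_of_pos_left ?_ ?_⟩
  · simpa using hxy
  · rw [tail_zero]
    exact div_pos (D_sum_pos hP) hP.2.2.2

theorem exists_genFun_eq_one {L : ℕ} {P : ℝ × (Fin L → ℝ)} (hP : P ∈ D L) :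
    ∃ x, 0 < x ∧ x < 1 ∧ genFun P x = 1 := by
  have h0 : genFun P 0 = 0 := by simp [genFun]
  have h1 : 1 < genFun P 1 := by
    rw [genFun_eq]
    have : ∑ k : Fin L, P.2 k / P.1 * ∑ m ∈ range ((k : ℕ) + 1), (1 : ℝ) ^ (m + 1) =
        (∑ k : Fin L, ((k : ℝ) + 1) * P.2 k) / P.1 := by
      rw [sum_div]
      refine sum_congr rfl fun k _ => ?_
      simp
      ring
    rw [this, one_lt_div hP.2.2.2]
    exact hP.2.1
  have hcont : Continuous (genFun P) := by unfold genFun; fun_prop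
  obtain ⟨x, hx, hx1⟩ := intermediate_value_Ioo zero_le_one hcont.continuousOn
    (show (1 : ℝ) ∈ Set.Ioo (genFun P 0) (genFun P 1) from ⟨by rw [h0]; exact one_pos, h1⟩)
  exact ⟨x, hx.1, hx.2, hx1⟩

/-- A root `x` of `genFun P = 1` yields a positive eigenvector for `x⁻¹`. -/
theorem offspringMatrix_mul_eigenvector {L : ℕ} {P : ℝ × (Fin L → ℝ)} {x : ℝ} (hx : 0 < x)
    (h : genFun P x = 1) (a : Fin L) :
    ∑ b, offspringMatrix P a b * ∑ m ∈ range ((b : ℕ) + 1), x ^ (m + 1) =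
      x⁻¹ * ∑ m ∈ range ((a : ℕ) + 1), x ^ (m + 1) := by
  simp only [offspringMatrix, Matrix.of_apply, add_mul, sum_add_distrib]
  -- The common row contributes `1 = x⁻¹ * x`; the subdiagonal supplies the remaining terms, shifted
  -- by one power of `x`.
  rw [← genFun_eq, h, sum_range_succ', mul_add, mul_sum]
  have hsub : ∑ b : Fin L, (if (a : ℕ) = (b : ℕ) + 1 then (1 : ℝ) else 0) *
      ∑ m ∈ range ((b : ℕ) + 1), x ^ (m + 1) = ∑ m ∈ range (a : ℕ), x ^ (m + 1) := by
    rcases Nat.eq_zero_or_pos (a : ℕ) with ha | ha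
    · rw [ha, range_zero, sum_empty]
      exact sum_eq_zero fun b _ => by rw [if_neg (by omega), zero_mul]
    · rw [sum_eq_single (⟨(a : ℕ) - 1, by omega⟩ : Fin L)]
      · rw [if_pos (by simp; omega), one_mul]
        congr 2
        simp; omega
      · intro b _ hb
        rw [if_neg, zero_mul]
        intro hab
        exact hb (Fin.ext (by simp; omega))
      · simp
  rw [hsub, add_comm]
  congr 1
  · refine sum_congr rfl fun m _ => ?_
    rw [pow_succ x (m + 1)]
    field_simp
  · rw [zero_add, pow_one, inv_mul_cancel₀ hx.ne']

/-- The spectral description of the offspring matrix. -/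
theorem offspringMatrix_spectrum {L : ℕ} {P : ℝ × (Fin L → ℝ)} (hP : P ∈ D L) {x : ℝ}
    (hx : 0 < x) (h : genFun P x = 1) :
    IsGreatest {μ : ℝ | Module.End.HasEigenvalue (Matrix.toLin' (offspringMatrix P)) μ} x⁻¹ ∧
      spectralRadius ℂ ((offspringMatrix P).map (fun x : ℝ => (x : ℂ))) = ENNReal.ofReal x⁻¹ := by
  set M := offspringMatrix P with hMdef
  set v : Fin L → ℝ := fun a => ∑ m ∈ range ((a : ℕ) + 1), x ^ (m + 1) with hvdef
  have hv : ∀ a, 0 < v a := fun a => sum_pos (fun m _ => by positivity) (by simp)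
  have hM : ∀ a b, 0 ≤ M a b := fun a b => by
    rw [hMdef, offspringMatrix, Matrix.of_apply]
    refine add_nonneg (div_nonneg (hP.2.2.1 b) hP.2.2.2.le) ?_
    split_ifs <;> norm_num
  have hMv : ∀ a, ∑ b, M a b * v b = x⁻¹ * v a := offspringMatrix_mul_eigenvector hx h
  have ⟨a₀⟩ : Nonempty (Fin L) := ⟨⟨0, D_length_pos hP⟩⟩
  have hx' : 0 < x⁻¹ := inv_pos.2 hx
  refine ⟨⟨?_, ?_⟩, le_antisymm ?_ ?_⟩
  · refine Module.End.hasEigenvalue_of_hasEigenvector (x := v)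
      (Module.End.hasEigenvector_iff.2 ⟨Module.End.mem_eigenspace_iff.2 ?_, ?_⟩)
    · funext a
      simpa [Matrix.toLin'_apply, Matrix.mulVec, dotProduct] using hMv a
    · intro h0
      exact (hv a₀).ne' (congrFun h0 a₀)
  · intro μ hμ
    obtain ⟨z, hz⟩ := Module.End.HasEigenvalue.exists_hasEigenvector hμ
    have hz1 := hz.apply_eq_smul
    refine (le_abs_self μ).trans (le_of_pos_eigenvector hM hv hMv (y := fun a => |z a|)
      (fun a => abs_nonneg _) (fun h0 => hz.2 ?_) fun a => ?_)
    · funext a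
      simpa using congrFun h0 a
    · have := congrFun hz1 a
      simp only [Matrix.toLin'_apply, Matrix.mulVec, dotProduct, Pi.smul_apply, smul_eq_mul] at this
      rw [← abs_mul, ← this]
      refine (abs_sum_le_sum_abs _ _).trans (sum_le_sum fun b _ => ?_)
      rw [abs_mul, abs_of_nonneg (hM a b)]
  · refine iSup₂_le fun μ hμ => ?_
    rw [← Matrix.spectrum_toLin', ← Module.End.hasEigenvalue_iff_mem_spectrum] at hμ
    obtain ⟨z, hz⟩ := Module.End.HasEigenvalue.exists_hasEigenvector hμ
    have hz1 := hz.apply_eq_smul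
    have hle : ‖μ‖ ≤ x⁻¹ := by
      refine le_of_pos_eigenvector hM hv hMv (y := fun a => ‖z a‖)
        (fun a => norm_nonneg _) (fun h0 => hz.2 ?_) fun a => ?_
      · funext a
        simpa using congrFun h0 a
      · have := congrFun hz1 a
        simp only [Matrix.toLin'_apply, Matrix.mulVec, dotProduct, Pi.smul_apply, smul_eq_mul,
          Matrix.map_apply] at this
        rw [← norm_mul, ← this]
        refine (norm_sum_le _ _).trans (sum_le_sum fun b _ => ?_)
        rw [norm_mul, Complex.norm_real, Real.norm_of_nonneg (hM a b)]
    rw [← enorm_eq_nnnorm, ← ofReal_norm]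
    exact ENNReal.ofReal_le_ofReal hle
  · have hmem : ((x⁻¹ : ℝ) : ℂ) ∈ spectrum ℂ (M.map (fun x : ℝ => (x : ℂ))) := by
      rw [← Matrix.spectrum_toLin', ← Module.End.hasEigenvalue_iff_mem_spectrum]
      refine Module.End.hasEigenvalue_of_hasEigenvector (x := fun a => (v a : ℂ))
        (Module.End.hasEigenvector_iff.2 ⟨Module.End.mem_eigenspace_iff.2 ?_, ?_⟩)
      · funext a
        simp only [Matrix.toLin'_apply, Matrix.mulVec, dotProduct, Pi.smul_apply, smul_eq_mul,
          Matrix.map_apply]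
        exact_mod_cast hMv a
      · intro h0
        exact (hv a₀).ne' (Complex.ofReal_eq_zero.1 (congrFun h0 a₀))
    refine le_trans ?_ (le_iSup₂ (f := fun k (_ : k ∈ spectrum ℂ (M.map (fun x : ℝ => (x : ℂ)))) =>
      (‖k‖₊ : ENNReal)) _ hmem)
    rw [← enorm_eq_nnnorm, ← ofReal_norm, Complex.norm_real, Real.norm_of_nonneg hx'.le]

/-! ### Stationary measures of the walk -/

theorem transition_nonneg {L : ℕ} {p : ℕ → ℝ} {q : ℕ → Fin L → ℝ} (h : IsStepLaw p q)
    (i j : ℕ) : 0 ≤ transition p q i j := by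
  unfold transition
  rcases Nat.eq_zero_or_pos i with hi | hi
  · rw [if_pos hi]; split_ifs <;> norm_num
  · obtain ⟨h1, -, h3, -⟩ := h i hi
    rw [if_neg hi.ne']
    refine add_nonneg ?_ (sum_nonneg fun k _ => ?_)
    · split_ifs; exacts [h1.le, le_rfl]
    · split_ifs; exacts [h3 k, le_rfl]

theorem hasSum_transition {L : ℕ} {p : ℕ → ℝ} {q : ℕ → Fin L → ℝ} (h : IsStepLaw p q) (i : ℕ) :
    HasSum (transition p q i) 1 := by
  rcases Nat.eq_zero_or_pos i with hi | hi
  · have : transition p q i = fun j => if j = 1 then 1 else 0 := by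
      funext j; rw [transition, if_pos hi]
    rw [this]
    exact hasSum_ite_eq 1 1
  · have : transition p q i = fun j => (if j = i + 1 then p i else 0) +
        ∑ k : Fin L, if j = i - ((k : ℕ) + 1) then q i k else 0 := by
      funext j; rw [transition, if_neg hi.ne']
    rw [this, ← (h i hi).2.2.2]
    exact (hasSum_ite_eq _ _).add (hasSum_sum fun k _ => hasSum_ite_eq _ _)

/-- Irreducibility: a nonzero nonnegative invariant measure of the walk is positive. -/
theorem invariant_pos {L : ℕ} {p : ℕ → ℝ} {q : ℕ → Fin L → ℝ} (h : IsStepLaw p q)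
    {ν : ℕ → ℝ} (hν : ∀ i, 0 ≤ ν i)
    (hinv : ∀ j, HasSum (fun i => ν i * transition p q i j) (ν j)) {i₀ : ℕ} (hi₀ : 0 < ν i₀)
    (i : ℕ) : 0 < ν i := by
  have move : ∀ i j, 0 < ν i → 0 < transition p q i j → 0 < ν j := fun i j hi hij =>
    (mul_pos hi hij).trans_le
      (le_hasSum (hinv j) i fun l _ => mul_nonneg (hν l) (transition_nonneg h l j))
  -- Since `p i < 1`, some downward jump has positive probability at every `i ≥ 1`, so 0 is reached;
  -- from 0 upward steps reach every state.
  have down : ∀ i, 0 < ν i → 0 < ν 0 := by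
    intro i
    induction i using Nat.strong_induction_on with
    | _ i ih =>
      intro hi
      rcases Nat.eq_zero_or_pos i with rfl | hpos
      · exact hi
      obtain ⟨h1, h2, h3, h4⟩ := h i hpos
      obtain ⟨k, -, hk⟩ : ∃ k ∈ (univ : Finset (Fin L)), 0 < q i k :=
        exists_lt_of_sum_lt (f := fun _ => (0 : ℝ)) (by simp; linarith)
      refine ih (i - ((k : ℕ) + 1)) (by omega) (move i _ hi ?_)
      rw [transition, if_neg hpos.ne']
      refine add_pos_of_nonneg_of_pos (by split_ifs; exacts [h1.le, le_rfl]) ?_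
      refine sum_pos' (fun l _ => by split_ifs; exacts [h3 l, le_rfl]) ⟨k, mem_univ k, ?_⟩
      rwa [if_pos rfl]
  induction i with
  | zero => exact down i₀ hi₀
  | succ i ih =>
    refine move i _ ih ?_
    unfold transition
    rcases Nat.eq_zero_or_pos i with rfl | hpos
    · simp
    · rw [if_neg hpos.ne', if_pos rfl]
      refine add_pos_of_pos_of_nonneg (h i hpos).1 (sum_nonneg fun k _ => ?_)
      split_ifs; exacts [(h i hpos).2.2.1 k, le_rfl]

/-- The absolute value of a summable signed invariant measure is invariant. -/
theorem invariant_abs {T : ℕ → ℕ → ℝ} (hT : ∀ i j, 0 ≤ T i j) (hT1 : ∀ i, HasSum (T i) 1)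
    {σ : ℕ → ℝ} (hσ : Summable fun i => |σ i|) (hinv : ∀ j, HasSum (fun i => σ i * T i j) (σ j))
    (j : ℕ) : HasSum (fun i => |σ i| * T i j) |σ j| := by
  set F : ℕ × ℕ → ℝ := fun z => |σ z.1| * T z.1 z.2 with hF
  have hrow : ∀ i, HasSum (fun j => F (i, j)) |σ i| := fun i => by
    simpa [hF] using (hT1 i).mul_left |σ i|
  have hFs : Summable F := by
    refine (summable_prod_of_nonneg fun z => mul_nonneg (abs_nonneg _) (hT _ _)).2
      ⟨fun i => (hrow i).summable, ?_⟩
    exact hσ.congr fun i => ((hrow i).tsum_eq).symm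
  have hcol : ∀ j, Summable fun i => F (i, j) := fun j => hFs.prod_symm.prod_factor j
  have hFsum : HasSum F (∑' i, |σ i|) := by
    have h1 := hFs.hasSum
    rwa [hFs.tsum_prod, tsum_congr fun i => (hrow i).tsum_eq] at h1
  have hswap : HasSum (fun j => ∑' i, F (i, j)) (∑' i, |σ i|) := by
    have h1 : HasSum (fun z : ℕ × ℕ => F z.swap) (∑' i, |σ i|) :=
      (Equiv.prodComm ℕ ℕ).hasSum_iff.2 hFsum
    exact h1.prod_fiberwise fun j => (hcol j).hasSum
  -- Triangle inequality. Both sides have the same finite total over `j`, as the rows of `T` sum to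
  -- 1, so equality holds termwise.
  have hle : ∀ j, |σ j| ≤ ∑' i, F (i, j) := fun j => by
    rw [← (hinv j).tsum_eq]
    have habs : ∀ i, ‖σ i * T i j‖ = F (i, j) := fun i => by
      rw [Real.norm_eq_abs, abs_mul, abs_of_nonneg (hT i j)]
    have := norm_tsum_le_tsum_norm (f := fun i => σ i * T i j) (by simpa only [habs] using hcol j)
    simpa only [habs, Real.norm_eq_abs] using this
  have hdiff : HasSum (fun j => (∑' i, F (i, j)) - |σ j|) 0 := by
    simpa using hswap.sub hσ.hasSum
  have hz := (hasSum_zero_iff_of_nonneg fun j => sub_nonneg.2 (hle j)).1 hdiff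
  have hj : (∑' i, F (i, j)) = |σ j| := sub_eq_zero.1 (congrFun hz j)
  rw [← hj]
  exact (hcol j).hasSum

/-- The difference `σ` has total mass 0, and `|σ| + σ` is invariant. If `σ` is positive somewhere,
irreducibility makes `|σ| + σ` positive everywhere, so `σ` is nowhere negative, contradicting mass
0. Hence `σ ≤ 0`, and mass 0 gives `σ = 0`. -/
theorem stationary_unique {L : ℕ} {p : ℕ → ℝ} {q : ℕ → Fin L → ℝ} (h : IsStepLaw p q)
    {π π' : ℕ → ℝ} (hπ : IsStationaryDistribution (transition p q) π)
    (hπ' : IsStationaryDistribution (transition p q) π') : π' = π := by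
  set σ : ℕ → ℝ := fun i => π' i - π i with hσdef
  have hσ0 : HasSum σ 0 := by simpa using hπ'.2.1.sub hπ.2.1
  have hinv : ∀ j, HasSum (fun i => σ i * transition p q i j) (σ j) := fun j => by
    simpa only [hσdef, sub_mul] using (hπ'.2.2 j).sub (hπ.2.2 j)
  have habs := invariant_abs (transition_nonneg h) (hasSum_transition h) hσ0.summable.abs hinv
  have hnp : ∀ i, σ i ≤ 0 := by
    intro i
    by_contra! hi
    have hall := invariant_pos h (ν := fun i => |σ i| + σ i)
      (fun i => by linarith [neg_abs_le (σ i)])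
      (fun j => by simpa only [add_mul] using (habs j).add (hinv j)) (i₀ := i)
      (add_pos_of_nonneg_of_pos (abs_nonneg _) hi)
    have hpos : ∀ i, 0 ≤ σ i := fun i => by
      by_contra! hn
      have := hall i
      simp only [abs_of_neg hn] at this
      linarith
    exact hi.ne' (congrFun ((hasSum_zero_iff_of_nonneg hpos).1 hσ0) i)
  have hz := (hasSum_zero_iff_of_nonneg (f := fun i => -σ i) fun i => neg_nonneg.2 (hnp i)).1
    (by simpa using hσ0.neg)
  funext i
  have : -σ i = 0 := congrFun hz i
  simp only [hσdef] at this
  linarith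

/-! ### Cut equations -/

/-- The probability of stepping up, including the certain step from `0`. -/
noncomputable def upProb (p : ℕ → ℝ) (i : ℕ) : ℝ := if i = 0 then 1 else p i

/-- The coefficients of the cut equations: the flow from `i` to `i + 1` balances the downward
jumps across this edge, which come from `i + m + 1` with `m < L`. -/
noncomputable def cutCoeff {L : ℕ} (p : ℕ → ℝ) (q : ℕ → Fin L → ℝ) (i m : ℕ) : ℝ :=
  tail (q (i + m + 1)) m / upProb p i

theorem upProb_pos {L : ℕ} {p : ℕ → ℝ} {q : ℕ → Fin L → ℝ} (h : IsStepLaw p q) (i : ℕ) :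
    0 < upProb p i := by
  unfold upProb
  split_ifs with hi
  exacts [one_pos, (h i (Nat.pos_of_ne_zero hi)).1]

theorem cutCoeff_nonneg {L : ℕ} {p : ℕ → ℝ} {q : ℕ → Fin L → ℝ} (h : IsStepLaw p q) (i m : ℕ) :
    0 ≤ cutCoeff p q i m :=
  div_nonneg (tail_nonneg (h _ (by omega)).2.2.1 m) (upProb_pos h i).le

theorem cutCoeff_zero_pos {L : ℕ} {p : ℕ → ℝ} {q : ℕ → Fin L → ℝ} (h : IsStepLaw p q) (i : ℕ) :
    0 < cutCoeff p q i 0 := by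
  refine div_pos ?_ (upProb_pos h i)
  obtain ⟨-, h2, -, h4⟩ := h (i + 0 + 1) (by omega)
  rw [tail_zero]
  linarith

theorem tendsto_cutCoeff {L : ℕ} {p : ℕ → ℝ} {q : ℕ → Fin L → ℝ} {P : ℝ × (Fin L → ℝ)}
    (hP : P.1 ≠ 0) (hlim : Tendsto (fun i => (p i, q i)) atTop (𝓝 P)) (m : ℕ) :
    Tendsto (fun i => cutCoeff p q i m) atTop (𝓝 (tail P.2 m / P.1)) := by
  have hp : Tendsto p atTop (𝓝 P.1) := (continuous_fst.tendsto P).comp hlim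
  have hq : Tendsto q atTop (𝓝 P.2) := (continuous_snd.tendsto P).comp hlim
  refine Tendsto.div ?_ (hp.congr' ?_) hP
  · refine (((continuous_tail m).tendsto P.2).comp hq).comp
      (f := fun i => i + m + 1) (tendsto_atTop_mono (fun i => ?_) tendsto_id)
    simp only [id]; omega
  · filter_upwards [eventually_gt_atTop 0] with i hi
    rw [upProb, if_neg hi.ne']

/-- Truncation plays no role for a target other than 0: a jump of size `k + 1` lands on `n + 1` only
from `n + k + 2`. -/
theorem transition_succ_eq {L : ℕ} (p : ℕ → ℝ) (q : ℕ → Fin L → ℝ) (i n : ℕ) :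
    transition p q i (n + 1) = (if i = n then upProb p n else 0) +
      ∑ k : Fin L, if i = n + (k : ℕ) + 2 then q (n + (k : ℕ) + 2) k else 0 := by
  rcases Nat.eq_zero_or_pos i with rfl | hi
  · rw [transition, if_pos rfl, sum_eq_zero fun k _ => if_neg (by omega), add_zero]
    by_cases hn : n = 0
    · subst hn; simp [upProb]
    · rw [if_neg (by omega), if_neg (by omega)]
  · rw [transition, if_neg hi.ne']
    congr 1
    · by_cases hn : i = n
      · subst hn; rw [if_pos rfl, if_pos rfl, upProb, if_neg hi.ne']
      · rw [if_neg (by omega), if_neg hn]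
    · refine sum_congr rfl fun k _ => ?_
      by_cases hk : i = n + (k : ℕ) + 2
      · rw [if_pos (by omega), if_pos hk, hk]
      · rw [if_neg (by omega), if_neg hk]

/-- A solution of the cut equations is an invariant measure of the walk. -/
theorem invariant_of_cut {L : ℕ} {p : ℕ → ℝ} {q : ℕ → Fin L → ℝ} (h : IsStepLaw p q)
    {u : ℕ → ℝ} (hcut : ∀ i, u i = ∑ m ∈ range L, cutCoeff p q i m * u (i + m + 1)) (j : ℕ) :
    HasSum (fun i => u i * transition p q i j) (u j) := by
  have hcut' : ∀ i, u i * upProb p i =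
      ∑ m ∈ range L, u (i + m + 1) * tail (q (i + m + 1)) m := by
    intro i
    rw [hcut i, sum_mul]
    refine sum_congr rfl fun m _ => ?_
    have := (upProb_pos h i).ne'
    rw [cutCoeff]
    field_simp
  cases j with
  | zero =>
    -- All jumps of size at least `i + 1` reach 0, so invariance at 0 is the cut equation at 0.
    have hT : ∀ i, transition p q (i + 1) 0 = tail (q (i + 1)) i := by
      intro i
      rw [transition, if_neg (by omega), if_neg (by omega), zero_add, tail]
      refine sum_congr rfl fun k _ => ?_
      by_cases hk : i ≤ (k : ℕ)
      · rw [if_pos (by omega), if_pos hk]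
      · rw [if_neg (by omega), if_neg hk]
    have key : ∑ i ∈ range (L + 1), u i * transition p q i 0 = u 0 := by
      rw [sum_range_succ', show transition p q 0 0 = 0 by simp [transition], mul_zero, add_zero]
      have := hcut' 0
      rw [upProb, if_pos rfl, mul_one] at this
      rw [this]
      exact sum_congr rfl fun m _ => by rw [hT, zero_add]
    have hs := hasSum_sum_of_ne_finset_zero (L := .unconditional ℕ) (f := fun i => u i * transition p q i 0)
      (s := range (L + 1)) fun i hi => by
        obtain ⟨d, rfl⟩ : ∃ d, i = d + 1 := ⟨i - 1, by have := mt mem_range.2 hi; omega⟩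
        have hd : L ≤ d := by have := mt mem_range.2 hi; omega
        rw [hT, tail, sum_eq_zero fun k _ => if_neg (by omega), mul_zero]
    rwa [key] at hs
  | succ n =>
    have hs : HasSum (fun i => u i * transition p q i (n + 1)) (u n * upProb p n +
        ∑ k : Fin L, u (n + (k : ℕ) + 2) * q (n + (k : ℕ) + 2) k) := by
      have : (fun i => u i * transition p q i (n + 1)) = fun i =>
          (if i = n then u n * upProb p n else 0) + ∑ k : Fin L,
            if i = n + (k : ℕ) + 2 then u (n + (k : ℕ) + 2) * q (n + (k : ℕ) + 2) k else 0 := by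
        funext i
        rw [transition_succ_eq, mul_add, mul_sum]
        congr 1
        · split_ifs with hi
          · rw [hi]
          · rw [mul_zero]
        · refine sum_congr rfl fun k _ => ?_
          split_ifs with hi
          · rw [hi]
          · rw [mul_zero]
      rw [this]
      exact (hasSum_ite_eq _ _).add (hasSum_sum fun k _ => hasSum_ite_eq _ _)
    convert hs using 1
    -- Invariance at `n + 1` is the difference of the cut equations at `n` and `n + 1`. As `tail _ L
    -- = 0`, the first sum extends to `L + 1` terms, and removing its initial term aligns it with
    -- the second.
    have e1 : u n * upProb p n = u (n + 1) * tail (q (n + 1)) 0 +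
        ∑ k : Fin L, u (n + (k : ℕ) + 2) * tail (q (n + (k : ℕ) + 2)) ((k : ℕ) + 1) := by
      have e := sum_range_succ (fun m => u (n + m + 1) * tail (q (n + m + 1)) m) L
      rw [tail_length, mul_zero, add_zero, ← hcut' n, sum_range_succ', sum_range] at e
      rw [← e, add_comm]
      rfl
    have e2 : u (n + 1) * p (n + 1) =
        ∑ k : Fin L, u (n + (k : ℕ) + 2) * tail (q (n + (k : ℕ) + 2)) k := by
      have e := hcut' (n + 1)
      rw [upProb, if_neg (by omega), sum_range] at e
      rw [e]
      refine sum_congr rfl fun k _ => ?_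
      rw [show n + 1 + (k : ℕ) + 1 = n + (k : ℕ) + 2 by ring]
    have e3 : ∑ k : Fin L, u (n + (k : ℕ) + 2) * tail (q (n + (k : ℕ) + 2)) k =
        ∑ k : Fin L, u (n + (k : ℕ) + 2) * q (n + (k : ℕ) + 2) k +
        ∑ k : Fin L, u (n + (k : ℕ) + 2) * tail (q (n + (k : ℕ) + 2)) ((k : ℕ) + 1) := by
      rw [← sum_add_distrib]
      exact sum_congr rfl fun k _ => by rw [tail_eq_add, mul_add]
    have e4 : u (n + 1) = u (n + 1) * p (n + 1) + u (n + 1) * tail (q (n + 1)) 0 := by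
      rw [← mul_add, tail_zero, (h (n + 1) (by omega)).2.2.2, mul_one]
    linarith

/-- Existence, uniqueness, positivity and exponential decay rate of the stationary distribution. -/
theorem exists_stationary {L : ℕ} {P : ℝ × (Fin L → ℝ)} (hP : P ∈ D L) {x₀ : ℝ} (hx₀ : 0 < x₀)
    (hx₁ : x₀ < 1) (hroot : genFun P x₀ = 1) {p : ℕ → ℝ} {q : ℕ → Fin L → ℝ}
    (h : IsStepLaw p q) (hlim : Tendsto (fun i => (p i, q i)) atTop (𝓝 P)) :
    ∃ π : ℕ → ℝ, IsStationaryDistribution (transition p q) π ∧ (∀ i, 0 < π i) ∧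
      Tendsto (fun i : ℕ => Real.log (π i) / (i : ℝ)) atTop (𝓝 (Real.log x₀)) := by
  have hL := D_length_pos hP
  set a := cutCoeff p q with ha_def
  have ha := cutCoeff_nonneg h
  have ha0 := cutCoeff_zero_pos h
  have hconv := tendsto_cutCoeff hP.2.2.2.ne' hlim
  obtain ⟨c, hc, hcl⟩ : ∃ c : ℝ, 0 < c ∧ c < tail P.2 0 / P.1 :=
    exists_between (div_pos (by rw [tail_zero]; exact D_sum_pos hP) hP.2.2.2)
  have hac : ∀ᶠ i in atTop, c ≤ a i 0 :=
    ((hconv 0).eventually (lt_mem_nhds hcl)).mono fun _ hi => hi.le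
  have hgen : ∀ x, Tendsto (fun i => ∑ m ∈ range L, a i m * x ^ (m + 1)) atTop
      (𝓝 (genFun P x)) := fun x =>
    tendsto_finsetSum _ fun m _ => (hconv m).mul_const _
  have hge : ∀ x, x₀ < x → ∀ᶠ i in atTop, 1 ≤ ∑ m ∈ range L, a i m * x ^ (m + 1) := by
    intro x hx
    have : 1 < genFun P x := hroot ▸ genFun_strictMonoOn hP hx₀.le (hx₀.trans hx).le hx
    exact ((hgen x).eventually (lt_mem_nhds this)).mono fun _ hi => hi.le
  have hle : ∀ x, 0 < x → x < x₀ → ∀ᶠ i in atTop, ∑ m ∈ range L, a i m * x ^ (m + 1) ≤ 1 := by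
    intro x hx hx'
    have : genFun P x < 1 := hroot ▸ genFun_strictMonoOn hP hx.le hx₀.le hx'
    exact ((hgen x).eventually (gt_mem_nhds this)).mono fun _ hi => hi.le
  -- A ratio strictly between the root and 1 makes the constructed solution summable.
  obtain ⟨x, hx, hx1⟩ := exists_between hx₁
  obtain ⟨C, u, hu, hu0, hub, hcut⟩ :=
    exists_solution hL hc (hx₀.trans hx) ha ha0 hac (hge x hx)
  have husum : Summable u := Summable.of_nonneg_of_le hu hub
    ((summable_geometric_of_lt_one (hx₀.trans hx).le hx1).mul_left C)
  set S := ∑' i, u i with hS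
  have hSpos : 0 < S := husum.tsum_pos hu 0 (by rw [hu0]; exact one_pos)
  set π : ℕ → ℝ := fun i => u i / S with hπ
  have hπcut : ∀ i, π i = ∑ m ∈ range L, a i m * π (i + m + 1) := fun i => by
    simp only [hπ]
    rw [hcut i, sum_div]
    exact sum_congr rfl fun m _ => mul_div_assoc ..
  have hπ0 : ∀ i, 0 ≤ π i := fun i => div_nonneg (hu i) hSpos.le
  have hinv := invariant_of_cut h hπcut
  have hpos : ∀ i, 0 < π i := invariant_pos h hπ0 hinv (i₀ := 0)
    (div_pos (by rw [hu0]; exact one_pos) hSpos)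
  refine ⟨π, ⟨hπ0, ?_, hinv⟩, hpos, tendsto_log_div hpos hx₀ (fun y hy => ?_) fun y hy hy' => ?_⟩
  · rw [← div_self hSpos.ne']
    exact husum.hasSum.div_const S
  · obtain ⟨B, hB, hbound⟩ :=
      exists_supersolution_bound hL hc (hx₀.trans hy) ha ha0 hac (hge y hy)
    refine ⟨B * π 0, mul_pos hB (hpos 0), Eventually.of_forall fun n => ?_⟩
    have := hbound π hπ0 (fun i => (hπcut i).ge) n
    linarith
  · exact exists_solution_lower_bound hL hc hy ha hac (hle y hy hy') hpos hπcut

end L1Walk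

theorem theorem1p3 (L : ℕ) (P : ℝ × (Fin L → ℝ)) (hP : P ∈ L1Walk.D L) :
    (IsGreatest {μ : ℝ | Module.End.HasEigenvalue (Matrix.toLin' (L1Walk.offspringMatrix P)) μ}
        (L1Walk.maxEigenvalue (L1Walk.offspringMatrix P)) ∧
      spectralRadius ℂ ((L1Walk.offspringMatrix P).map (fun x : ℝ => (x : ℂ))) =
        ENNReal.ofReal (L1Walk.maxEigenvalue (L1Walk.offspringMatrix P)) ∧
      1 < L1Walk.maxEigenvalue (L1Walk.offspringMatrix P)) ∧
    ∀ (p : ℕ → ℝ) (q : ℕ → Fin L → ℝ), L1Walk.IsStepLaw p q →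
      Tendsto (fun i => (p i, q i)) atTop (𝓝 P) →
      ∃ π : ℕ → ℝ,
        L1Walk.IsStationaryDistribution (L1Walk.transition p q) π ∧
        (∀ π' : ℕ → ℝ,
          L1Walk.IsStationaryDistribution (L1Walk.transition p q) π' → π' = π) ∧
        (∀ i, 0 < π i) ∧
        Tendsto (fun i : ℕ => Real.log (π i) / (i : ℝ)) atTop
          (𝓝 (-Real.log (L1Walk.maxEigenvalue (L1Walk.offspringMatrix P)))) := by
  obtain ⟨x, hx0, hx1, hroot⟩ := L1Walk.exists_genFun_eq_one hP
  obtain ⟨hgreat, hspec⟩ := L1Walk.offspringMatrix_spectrum hP hx0 hroot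
  have hmax : L1Walk.maxEigenvalue (L1Walk.offspringMatrix P) = x⁻¹ := hgreat.csSup_eq
  rw [hmax]
  refine ⟨⟨hgreat, hspec, (one_lt_inv₀ hx0).2 hx1⟩, fun p q hpq hlim => ?_⟩
  obtain ⟨π, hπ, hpos, htend⟩ := L1Walk.exists_stationary hP hx0 hx1 hroot hpq hlim
  refine ⟨π, hπ, fun π' hπ' => L1Walk.stationary_unique hpq hπ hπ', hpos, ?_⟩
  rwa [Real.log_inv, neg_neg]
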